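/- Let $n\ge 1$, $p\ge 1$ real, $I=[t,T]$ with $t<T$, and let $B_r$ be the closed ball of radius $r$ centred at $0$ in $\mathbb R^n$. Let $\Lambda:I\times\mathbb R^n\times\mathbb R^n\to[0,+\infty]$ and $\Psi:I\times\mathbb R^n\to[0,+\infty]$ be Borel, and suppose that $\{\Lambda<+\infty\}=I\times D$ for some $D\subseteq\mathbb R^n\times\mathbb R^n$. For $y\in W^{1,p}(I;\mathbb R^n)$ put $$F(y)=\int_I\Lambda(s,y(s),y'(s))\,\Psi(s,y(s))\,ds\in[0,+\infty].$$ For $X,Y\in\mathbb R^n$ let $\Gamma_X=\{y\in W^{1,p}(I;\mathbb R^n): y(t)=X\}$ and $\Gamma_{X,Y}=\{y\in\Gamma_X: y(T)=Y\}$, and let $(\mathcal P_X)$, $(\mathcal P_{X,Y})$ be the problems of minimizing $F$ on $\Gamma_X$, respectively on $\Gamma_{X,Y}$; $\inf(\mathcal P_X)$ and $\inf(\mathcal P_{X,Y})$ denote the infima. The Lavrentiev phenomenon does not occur for the problem on $\Gamma\in\{\Gamma_X,\Gamma_{X,Y}\}$ if the infimum of $F$ on $\Gamma$ equals its infimum over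 the Lipschitz functions in $\Gamma$. Assume Condition (S): for every $K\ge 0$ there are $\kappa,\beta\ge 0$, $\gamma\in L^1(I)$ and $\varepsilon_*>0$ such that for a.e. $s\in I$ $$|\Lambda(s_2,z,v)-\Lambda(s_1,z,v)|\le\big(\kappa\Lambda(s,z,v)+\beta|v|^p+\gamma(s)\big)|s_2-s_1|$$ whenever $s_1,s_2\in[s-\varepsilon_*,s+\varepsilon_*]\cap I$, $z\in B_K$, $v\in\mathbb R^n$ and $\Lambda(s,z,v)<+\infty$. For $K>0$ consider the hypotheses: (B$_\Psi$) $\Psi$ is bounded on $I\times B_K$; (C$_\Psi$) $\Psi(\cdot,z)$ is continuous on $I$ for every $z\in B_K$; (P$_\Psi$) there is $m_{K,\Psi}>0$ with $\Psi\ge m_{K,\Psi}$ on $I\times B_K$; (B$_\Lambda$) there is $\nu_0>0$ such that $\Lambda$ is bounded on $I\times B_K\times B_{\nu_0}$; (U$_\Lambda$) for all $r>0$, $\Lambda$ is bounded on $I\times B_K\times B_r$. Then, for every $X\in\mathbb R^n$: (1) If (B$_\Psi$), (C$_\Psi$), (P$_\Psi$), (B$_\Lambda$) hold for all $K>0$,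 then the Lavrentiev phenomenon does not occur for $(\mathcal P_X)$. (2) If, moreover, $\Lambda$ is real valued and (U$_\Lambda$) holds for all $K>0$, then the Lavrentiev phenomenon does not occur for $(\mathcal P_{X,Y})$, for any $Y\in\mathbb R^n$. (3) Suppose that there are $\alpha>0$, $d\ge 0$ such that for a.e. $s\in I$ one has $\Lambda(s,z,v)\ge\alpha|v|-d$ for all $z,v\in\mathbb R^n$, and that $m_\Psi:=\inf_{I\times\mathbb R^n}\Psi>0$. Then the Lavrentiev phenomenon does not occur for $(\mathcal P_X)$ if (B$_\Psi$), (C$_\Psi$), (B$_\Lambda$) hold for just one value $$K>K_0:=|X|+\frac{\inf(\mathcal P_X)+m_\Psi d(T-t)}{m_\Psi\alpha};$$ and, for every $Y\in\mathbb R^n$, it does not occur for $(\mathcal P_{X,Y})$ if (B$_\Psi$), (C$_\Psi$), (B$_\Lambda$), (U$_\Lambda$) hold for just one value $$K>|X|+\frac{\inf(\mathcal P_{X,Y})+m_\Psi d(T-t)}{m_\Psi\alpha}.$$ -/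

import Mathlib

open MeasureTheory Set
open scoped ENNReal NNReal

noncomputable section

namespace Lavrentiev

/-- `ℝⁿ` with its Euclidean norm. -/
abbrev Rn (n : ℕ) : Type := EuclideanSpace ℝ (Fin n)

variable {n : ℕ}

/-! Lagrangians are `L = Λ Ψ` on the interval `I = [t, T]`. The functions `Λ`, `Ψ` and the
trajectories are written as functions of a real time variable, but only their values at times in
`[t, T]` enter any definition below. -/

/-- The basic assumptions: `Λ : I × ℝⁿ × ℝⁿ → [0, ∞]` and `Ψ : I × ℝⁿ → [0, ∞]` are Borel, and the
effective domain of `Λ` is a product `I × D`. -/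
structure BasicAssumptions (t T : ℝ) (Λ : ℝ → Rn n → Rn n → ℝ≥0∞) (Ψ : ℝ → Rn n → ℝ≥0∞) :
    Prop where
  borel_Λ : Measurable (fun q : Icc t T × Rn n × Rn n => Λ q.1 q.2.1 q.2.2)
  borel_Ψ : Measurable (fun q : Icc t T × Rn n => Ψ q.1 q.2)
  dom_prod : ∃ D : Set (Rn n × Rn n), ∀ s ∈ Icc t T, ∀ z v : Rn n, Λ s z v < ⊤ ↔ (z, v) ∈ D

/-- Condition (S): local Lipschitz continuity of `Λ` in time. All values of `Λ` in the inequality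
are finite, because the effective domain is a product `I × D`. -/
def ConditionS (p t T : ℝ) (Λ : ℝ → Rn n → Rn n → ℝ≥0∞) : Prop :=
  ∀ K : ℝ, 0 ≤ K → ∃ κ β : ℝ, 0 ≤ κ ∧ 0 ≤ β ∧ ∃ γ : ℝ → ℝ, IntegrableOn γ (Icc t T) ∧
    ∃ ε : ℝ, 0 < ε ∧ ∀ᵐ s ∂(volume.restrict (Icc t T)),
      ∀ s₁ ∈ Icc (s - ε) (s + ε) ∩ Icc t T, ∀ s₂ ∈ Icc (s - ε) (s + ε) ∩ Icc t T,
        ∀ z v : Rn n, ‖z‖ ≤ K → Λ s z v < ⊤ →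
          |(Λ s₂ z v).toReal - (Λ s₁ z v).toReal| ≤
            (κ * (Λ s z v).toReal + β * ‖v‖ ^ p + γ s) * |s₂ - s₁|

/-- (B_Ψ) at `K`: `Ψ` is bounded on `I × B_K`. -/
def BPsi (t T : ℝ) (Ψ : ℝ → Rn n → ℝ≥0∞) (K : ℝ) : Prop :=
  ∃ M : ℝ≥0, ∀ s ∈ Icc t T, ∀ z : Rn n, ‖z‖ ≤ K → Ψ s z ≤ M

/-- (C_Ψ) at `K`: `Ψ(·, z)` is continuous on `I` for every `z ∈ B_K`. -/
def CPsi (t T : ℝ) (Ψ : ℝ → Rn n → ℝ≥0∞) (K : ℝ) : Prop :=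
  ∀ z : Rn n, ‖z‖ ≤ K → ContinuousOn (fun s => Ψ s z) (Icc t T)

/-- (P_Ψ) at `K`: `Ψ` is bounded below by a positive constant on `I × B_K`. -/
def PPsi (t T : ℝ) (Ψ : ℝ → Rn n → ℝ≥0∞) (K : ℝ) : Prop :=
  ∃ m : ℝ≥0, 0 < m ∧ ∀ s ∈ Icc t T, ∀ z : Rn n, ‖z‖ ≤ K → (m : ℝ≥0∞) ≤ Ψ s z

/-- `Λ` is bounded on `I × B_K × B_r` (by a finite constant). -/
def BoundedOn (t T : ℝ) (Λ : ℝ → Rn n → Rn n → ℝ≥0∞) (K r : ℝ) : Prop :=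
  ∃ M : ℝ≥0, ∀ s ∈ Icc t T, ∀ z v : Rn n, ‖z‖ ≤ K → ‖v‖ ≤ r → Λ s z v ≤ M

/-- (B_Λ) at `K`: for some `ν₀ > 0`, `Λ` is bounded on `I × B_K × B_{ν₀}`. -/
def BLambda (t T : ℝ) (Λ : ℝ → Rn n → Rn n → ℝ≥0∞) (K : ℝ) : Prop :=
  ∃ ν₀ : ℝ, 0 < ν₀ ∧ BoundedOn t T Λ K ν₀

/-- (U_Λ) at `K`: for all `r > 0`, `Λ` is bounded on `I × B_K × B_r`. -/
def ULambda (t T : ℝ) (Λ : ℝ → Rn n → Rn n → ℝ≥0∞) (K : ℝ) : Prop :=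
  ∀ r : ℝ, 0 < r → BoundedOn t T Λ K r

/-- `Λ` is real valued on `I × ℝⁿ × ℝⁿ`. -/
def RealValued (t T : ℝ) (Λ : ℝ → Rn n → Rn n → ℝ≥0∞) : Prop :=
  ∀ s ∈ Icc t T, ∀ z v : Rn n, Λ s z v < ⊤

/-- (G_Λ) with constants `α`, `d`: linear growth from below, `Λ(s, z, v) ≥ α |v| - d`
(as `Λ ≥ 0`, only the positive part of the right-hand side matters). -/
def GLambda (t T : ℝ) (Λ : ℝ → Rn n → Rn n → ℝ≥0∞) (α d : ℝ) : Prop :=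
  ∀ᵐ s ∂(volume.restrict (Icc t T)), ∀ z v : Rn n, ENNReal.ofReal (α * ‖v‖ - d) ≤ Λ s z v

/-- The infimum of `Ψ` on `I × ℝⁿ`. -/
def infPsi (t T : ℝ) (Ψ : ℝ → Rn n → ℝ≥0∞) : ℝ≥0∞ :=
  ⨅ s ∈ Icc t T, ⨅ z : Rn n, Ψ s z

/-- `y ∈ W^{1,p}(I; ℝⁿ)`, `I = [t, T]`, for the continuous representative: `y` is absolutely
continuous on `I`, and `y` and its almost everywhere derivative `y'` are in `L^p(I)`. -/
structure MemW1p (p t T : ℝ) (y : ℝ → Rn n) : Prop where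
  absCont : AbsolutelyContinuousOnInterval y t T
  memLp : MemLp y (ENNReal.ofReal p) (volume.restrict (Icc t T))
  memLp_deriv : MemLp (deriv y) (ENNReal.ofReal p) (volume.restrict (Icc t T))

/-- `Lip(I; ℝⁿ)`: the functions that are Lipschitz on `I = [t, T]`. -/
def Lip (t T : ℝ) : Set (ℝ → Rn n) := {y | ∃ C : ℝ≥0, LipschitzOnWith C y (Icc t T)}

/-- The energy `F(y) = ∫_I Λ(s, y(s), y'(s)) Ψ(s, y(s)) ds ∈ [0, ∞]`. -/
def energy (t T : ℝ) (Λ : ℝ → Rn n → Rn n → ℝ≥0∞) (Ψ : ℝ → Rn n → ℝ≥0∞) (y : ℝ → Rn n) :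
    ℝ≥0∞ :=
  ∫⁻ s in Icc t T, Λ s (y s) (deriv y s) * Ψ s (y s)

/-- `Γ_X = {y ∈ W^{1,p}(I; ℝⁿ) : y(t) = X}`. -/
def Gamma₁ (p t T : ℝ) (X : Rn n) : Set (ℝ → Rn n) := {y | MemW1p p t T y ∧ y t = X}

/-- `Γ_{X,Y} = {y ∈ W^{1,p}(I; ℝⁿ) : y(t) = X, y(T) = Y}`. -/
def Gamma₂ (p t T : ℝ) (X Y : Rn n) : Set (ℝ → Rn n) :=
  {y | MemW1p p t T y ∧ y t = X ∧ y T = Y}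

/-- The infimum of the energy over a set `Γ` of trajectories (`+∞` if `Γ` is empty). -/
def infEnergy (t T : ℝ) (Λ : ℝ → Rn n → Rn n → ℝ≥0∞) (Ψ : ℝ → Rn n → ℝ≥0∞)
    (Γ : Set (ℝ → Rn n)) : ℝ≥0∞ :=
  ⨅ y ∈ Γ, energy t T Λ Ψ y

/-- The Lavrentiev phenomenon does not occur for the problem of minimizing the energy over `Γ`:
the infimum over `Γ` equals the infimum over the Lipschitz elements of `Γ`. -/
def NoLavrentiev (t T : ℝ) (Λ : ℝ → Rn n → Rn n → ℝ≥0∞) (Ψ : ℝ → Rn n → ℝ≥0∞)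
    (Γ : Set (ℝ → Rn n)) : Prop :=
  infEnergy t T Λ Ψ Γ = infEnergy t T Λ Ψ (Γ ∩ Lip t T)

/-- The threshold `K₀ = |X| + (ι + m d (T - t)) / (m α)`, where `m = inf Ψ` and `ι` is the infimum
of the minimization problem under consideration; it is `+∞` if `ι = +∞` and `0 < m < ∞`. -/
def K₀ (t T : ℝ) (Ψ : ℝ → Rn n → ℝ≥0∞) (X : Rn n) (α d : ℝ) (ι : ℝ≥0∞) : ℝ≥0∞ :=
  ENNReal.ofReal ‖X‖ + (ι + infPsi t T Ψ * ENNReal.ofReal (d * (T - t))) /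
    (infPsi t T Ψ * ENNReal.ofReal α)

end Lavrentiev

end

/-! A trajectory `y` of finite energy becomes Lipschitz after a change of time. Let φ be the
primitive of a density `g` with φ(t) = t, and put z = y ∘ φ⁻¹, so that z' = y'/g at corresponding
times. Take g = |y'|/R on the set where |y'| > ν, g = 1/2 on a set B inside {|y'| ≤ R}, and g = 1
elsewhere. Then |y'| ≤ C g, so z is C-Lipschitz (`exists_lipschitz_reparametrization`), and F(z) is
at most ∫ g Λ(φ, y, y'/g) Ψ(φ, y), with φ cut off at T.

Where g ≠ 1 the new speed is at most 2R. There Λ and Ψ are bounded, and the integral of g is small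
for large ν because y' is integrable; no growth of Λ is needed. Where g = 1 only the time has moved,
and by little: Condition (S) controls the change of Λ through an integrable weight, and continuity
of Ψ in time with dominated convergence controls the rest (`exists_lipschitz_energy_le_of_density`).

With a free endpoint B is empty: φ(T) ≥ T, the end of the path is dropped, and any R > 0 will do, so
boundedness for small speeds suffices. With a fixed endpoint the time gained on the fast set is
given back on B, which forces R large depending on `y`, whence (U_Λ). The proposition `e` in the
lemmas says whether T has to be preserved (`exists_density`).

Under linear growth, trajectories of energy close to the infimum stay in B_K as soon as K is above
the threshold, so the hypotheses at that single K suffice (`noLavrentiev_of_K₀_lt`). -/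

namespace Lavrentiev

open Filter Topology

/-! ### Absolutely continuous and Lipschitz curves -/

section AbsolutelyContinuous

variable {n : ℕ}

/-- Pairing `y` with the fixed vector w = y(b) - y(a) reduces to the scalar fundamental theorem of
calculus; Cauchy–Schwarz then gives |w|² ≤ |w| ∫ |y'|. -/
lemma norm_sub_le_integral_norm_deriv {y : ℝ → Rn n} {a b : ℝ} (hab : a ≤ b)
    (hy : AbsolutelyContinuousOnInterval y a b) (hi : IntervalIntegrable (deriv y) volume a b) :
    ‖y b - y a‖ ≤ ∫ x in a..b, ‖deriv y x‖ := by
  set w := y b - y a with hw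
  set f : ℝ → ℝ := fun x => inner ℝ w (y x) with hf
  have hfac : AbsolutelyContinuousOnInterval f a b := by
    have h0 : Tendsto (fun E : ℕ × (ℕ → ℝ × ℝ) =>
        ‖w‖ * ∑ i ∈ Finset.range E.1, dist (y (E.2 i).1) (y (E.2 i).2))
        (AbsolutelyContinuousOnInterval.totalLengthFilter ⊓
          𝓟 (AbsolutelyContinuousOnInterval.disjWithin a b)) (𝓝 0) := by
      simpa using Tendsto.const_mul ‖w‖ hy
    refine squeeze_zero (fun E => Finset.sum_nonneg fun _ _ => dist_nonneg) (fun E => ?_) h0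
    rw [Finset.mul_sum]
    refine Finset.sum_le_sum fun i _ => ?_
    rw [dist_eq_norm, dist_eq_norm, hf, ← inner_sub_right]
    exact norm_inner_le_norm _ _
  have hd : ∀ᵐ x, x ∈ uIcc a b → deriv f x = inner ℝ w (deriv y x) := by
    filter_upwards [hy.boundedVariationOn.ae_differentiableAt_of_mem_uIcc] with x hx hxm
    have := (hasDerivAt_const x w).inner ℝ (hx hxm).hasDerivAt
    simpa using this.deriv
  have h1 : f b - f a = ‖w‖ ^ 2 := by
    rw [hf, ← inner_sub_right, ← hw, real_inner_self_eq_norm_sq]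
  have h2 : f b - f a ≤ ‖w‖ * ∫ x in a..b, ‖deriv y x‖ := by
    rw [← hfac.integral_deriv_eq_sub, ← intervalIntegral.integral_const_mul]
    refine intervalIntegral.integral_mono_ae_restrict hab hfac.intervalIntegrable_deriv
      (hi.norm.const_mul _) ?_
    rw [EventuallyLE, ae_restrict_iff' measurableSet_Icc]
    filter_upwards [hd] with x hx hxm
    rw [hx (by rwa [uIcc_of_le hab])]
    exact real_inner_le_norm _ _
  rcases (norm_nonneg w).eq_or_lt with h | h
  · rw [← h]
    exact intervalIntegral.integral_nonneg hab fun _ _ => norm_nonneg _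
  · rw [h1, sq] at h2
    exact le_of_mul_le_mul_left h2 h

lemma memW1p_of_lipschitzOnWith {p t T : ℝ} (htT : t < T) {y : ℝ → Rn n} {C : ℝ≥0}
    (hy : LipschitzOnWith C y (Icc t T)) : MemW1p p t T y := by
  refine ⟨LipschitzOnWith.absolutelyContinuousOnInterval (K := C) (by rwa [uIcc_of_le htT.le]),
    ?_, ?_⟩
  · obtain ⟨M, hM⟩ := isCompact_Icc.exists_bound_of_continuousOn hy.continuousOn
    exact MemLp.of_bound (hy.continuousOn.aestronglyMeasurable measurableSet_Icc) M
      ((ae_restrict_iff' measurableSet_Icc).2 (Eventually.of_forall hM))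
  · refine MemLp.of_bound (measurable_deriv y).aestronglyMeasurable C ?_
    rw [← restrict_Ioo_eq_restrict_Icc, ae_restrict_iff' measurableSet_Ioo]
    exact Eventually.of_forall fun x hx =>
      norm_deriv_le_of_lipschitzOn (Icc_mem_nhds hx.1 hx.2) hy

lemma MemW1p.integrableOn_deriv {p t T : ℝ} (hp : 1 ≤ p) {y : ℝ → Rn n} (hy : MemW1p p t T y) :
    IntegrableOn (deriv y) (Icc t T) :=
  hy.memLp_deriv.integrable (by simpa using ENNReal.ofReal_le_ofReal hp)

end AbsolutelyContinuous

/-! ### Changes of time and reparametrization -/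

/-- The primitive of the density `g` that fixes `t`, used as a change of time. -/
noncomputable def timeChange (g : ℝ → ℝ) (t s : ℝ) : ℝ := t + ∫ x in t..s, g x

section TimeChange

variable {g : ℝ → ℝ} {c t T : ℝ}

lemma intervalIntegrable_of_locallyIntegrable (hg : LocallyIntegrable g) (a b : ℝ) :
    IntervalIntegrable g volume a b :=
  (hg.integrableOn_isCompact isCompact_uIcc).intervalIntegrable

@[simp] lemma timeChange_self (g : ℝ → ℝ) (t : ℝ) : timeChange g t t = t := by
  simp [timeChange]

lemma timeChange_sub (hg : LocallyIntegrable g) (t a b : ℝ) :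
    timeChange g t b - timeChange g t a = ∫ x in a..b, g x := by
  have := intervalIntegrable_of_locallyIntegrable hg
  rw [timeChange, timeChange, add_sub_add_left_eq_sub,
    intervalIntegral.integral_interval_sub_left (this _ _) (this _ _)]

lemma continuous_timeChange (hg : LocallyIntegrable g) (t : ℝ) : Continuous (timeChange g t) :=
  continuous_const.add (intervalIntegral.continuous_primitive
    (intervalIntegrable_of_locallyIntegrable hg) t)

lemma mul_sub_le_timeChange_sub (hg : LocallyIntegrable g) (hcg : ∀ x, c ≤ g x) (t : ℝ)
    {a b : ℝ} (hab : a ≤ b) : c * (b - a) ≤ timeChange g t b - timeChange g t a := by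
  rw [timeChange_sub hg]
  have := intervalIntegral.integral_mono_on hab (intervalIntegrable_const (c := c))
    (intervalIntegrable_of_locallyIntegrable hg a b) (fun x _ => hcg x)
  simpa [mul_comm] using this

lemma strictMono_timeChange (hg : LocallyIntegrable g) (hc : 0 < c) (hcg : ∀ x, c ≤ g x) (t : ℝ) :
    StrictMono (timeChange g t) := fun a b hab => by
  have := mul_sub_le_timeChange_sub hg hcg t hab.le
  have := mul_pos hc (sub_pos.2 hab)
  linarith

lemma surjective_timeChange (hg : LocallyIntegrable g) (hc : 0 < c) (hcg : ∀ x, c ≤ g x) (t : ℝ) :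
    Function.Surjective (timeChange g t) := by
  refine (continuous_timeChange hg t).surjective ?_ ?_
  · refine tendsto_atTop_mono' _ (f₁ := fun s => t + c * (s - t)) ?_ ?_
    · filter_upwards [eventually_ge_atTop t] with s hs
      have := mul_sub_le_timeChange_sub hg hcg t hs
      rw [timeChange_self] at this
      linarith
    · exact tendsto_atTop_add_const_left _ _
        ((tendsto_id.atTop_add tendsto_const_nhds).const_mul_atTop hc)
  · refine tendsto_atBot_mono' _ (f₁ := fun s => t + c * (s - t)) ?_ ?_
    · filter_upwards [eventually_le_atBot t] with s hs
      have := mul_sub_le_timeChange_sub hg hcg t hs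
      rw [timeChange_self] at this
      linarith
    · exact tendsto_atBot_add_const_left _ _
        ((tendsto_id.atBot_add tendsto_const_nhds).const_mul_atBot hc)

variable {n : ℕ}

/-- Reparametrizing an absolutely continuous `y` by a change of time whose density dominates `|y'|`
produces a Lipschitz function. -/
lemma exists_lipschitz_reparametrization (htT : t ≤ T) {y : ℝ → Rn n}
    (hy : AbsolutelyContinuousOnInterval y t T) (hyi : IntegrableOn (deriv y) (Icc t T))
    (hg : LocallyIntegrable g) (hc : 0 < c) (hcg : ∀ x, c ≤ g x)
    (hT : T ≤ timeChange g t T) {C : ℝ≥0} (hC : ∀ s ∈ Icc t T, ‖deriv y s‖ ≤ C * g s) :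
    ∃ z : ℝ → Rn n, LipschitzOnWith C z (Icc t T) ∧ z t = y t ∧
      (timeChange g t T = T → z T = y T) ∧
      ∀ L : ℝ → Rn n → Rn n → ℝ≥0∞, ∫⁻ s in Icc t T, L s (z s) (deriv z s) ≤
        ∫⁻ s in Icc t T, ENNReal.ofReal (g s) *
          L (min (timeChange g t s) T) (y s) ((g s)⁻¹ • deriv y s) := by
  set φ := timeChange g t with hφ
  have hmono : StrictMono φ := strictMono_timeChange hg hc hcg t
  have hcont : Continuous φ := continuous_timeChange hg t
  have hgpos : ∀ x, 0 < g x := fun x => hc.trans_le (hcg x)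
  let e : ℝ ≃o ℝ := StrictMono.orderIsoOfSurjective φ hmono (surjective_timeChange hg hc hcg t)
  have he : ∀ x, e.symm (φ x) = x := e.symm_apply_apply
  have he' : ∀ x, φ (e.symm x) = x := e.apply_symm_apply
  have hφt : φ t = t := timeChange_self g t
  have het : e.symm t = t := by rw [← hφt, he, hφt]
  have hmaps : ∀ τ ∈ Icc t T, e.symm τ ∈ Icc t T := fun τ hτ =>
    ⟨by rw [← hmono.le_iff_le, he', hφt]; exact hτ.1,
      by rw [← hmono.le_iff_le, he']; exact hτ.2.trans hT⟩
  have hyii : ∀ a ∈ Icc t T, ∀ b ∈ Icc t T, IntervalIntegrable (deriv y) volume a b :=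
    fun a ha b hb => (hyi.mono_set (uIcc_subset_Icc ha hb)).intervalIntegrable
  refine ⟨y ∘ e.symm, ?_, by simp [het], fun h => ?_, fun L => ?_⟩
  · refine LipschitzOnWith.of_dist_le_mul fun σ hσ τ hτ => ?_
    wlog hst : σ ≤ τ generalizing σ τ
    · rw [dist_comm, dist_comm σ]
      exact this τ hτ σ hσ (le_of_not_ge hst)
    have hab : e.symm σ ≤ e.symm τ := e.symm.monotone hst
    have ha := hmaps σ hσ
    have hb := hmaps τ hτ
    have hsub : uIcc (e.symm σ) (e.symm τ) ⊆ uIcc t T := by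
      rw [uIcc_of_le htT]; exact uIcc_subset_Icc ha hb
    rw [dist_comm, dist_eq_norm]
    calc ‖y (e.symm τ) - y (e.symm σ)‖ ≤ ∫ x in e.symm σ..e.symm τ, ‖deriv y x‖ :=
          norm_sub_le_integral_norm_deriv hab (hy.mono hsub) (hyii _ ha _ hb)
      _ ≤ ∫ x in e.symm σ..e.symm τ, C * g x :=
          intervalIntegral.integral_mono_on hab (hyii _ ha _ hb).norm
            ((intervalIntegrable_of_locallyIntegrable hg _ _).const_mul _)
            fun x hx => hC x ⟨ha.1.trans hx.1, hx.2.trans hb.2⟩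
      _ = C * dist σ τ := by
          rw [intervalIntegral.integral_const_mul, ← timeChange_sub hg t, ← hφ, he', he',
            dist_comm, Real.dist_eq, abs_of_nonneg (sub_nonneg.2 hst)]
  · have : e.symm T = T := by conv_lhs => rw [← h, he]
    simp [this]
  set z := y ∘ e.symm with hz
  have hae : ∀ᵐ x, x ∈ Icc t T → HasDerivAt φ (g x) x ∧ DifferentiableAt ℝ y x := by
    filter_upwards [LocallyIntegrable.ae_hasDerivAt_integral hg,
      hy.boundedVariationOn.ae_differentiableAt_of_mem_uIcc] with x hx hx' hxm
    exact ⟨(hx t).const_add t, hx' (by rwa [uIcc_of_le htT])⟩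
  -- A measurable null hull of the exceptional set is removed, so that `E` is measurable and both
  -- derivatives exist at every point of it.
  set N := toMeasurable volume {x | ¬ (x ∈ Icc t T → HasDerivAt φ (g x) x ∧ DifferentiableAt ℝ y x)}
  have hN : volume N = 0 := by rw [measure_toMeasurable]; exact hae
  set E := Icc t T \ N
  have hEm : MeasurableSet E := measurableSet_Icc.diff (measurableSet_toMeasurable _ _)
  have hE : ∀ x ∈ E, HasDerivAt φ (g x) x ∧ DifferentiableAt ℝ y x := fun x hx => by
    by_contra h
    exact hx.2 (subset_toMeasurable _ _ fun h' => h (h' hx.1))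
  have hEae : E =ᵐ[volume] Icc t T := sdiff_null_ae_eq_self hN
  have hcv : ∀ H : ℝ → ℝ≥0∞,
      ∫⁻ x in φ '' E, H x = ∫⁻ x in Icc t T, ENNReal.ofReal (g x) * H (φ x) := fun H => by
    rw [lintegral_image_eq_lintegral_abs_deriv_mul hEm
      (fun x hx => (hE x hx).1.hasDerivWithinAt) hmono.injective.injOn, setLIntegral_congr hEae]
    simp only [abs_of_pos (hgpos _)]
  -- With H = 1 the change of variables gives |φ(E)| = ∫ g = φ(T) - t, so φ(E) fills [t, φ(T)] up to
  -- a null set, and z' need only be known on φ(E).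
  have hvol : volume (φ '' E) = volume (Icc t (φ T)) := by
    have := hcv 1
    simp only [Pi.one_apply, lintegral_one, Measure.restrict_apply_univ, mul_one] at this
    rw [this, ← ofReal_integral_eq_lintegral_ofReal (hg.integrableOn_isCompact isCompact_Icc)
      (Eventually.of_forall fun x => (hgpos x).le), Real.volume_Icc, integral_Icc_eq_integral_Ioc,
      ← intervalIntegral.integral_of_le htT, ← timeChange_sub hg t, timeChange_self]
  have him : φ '' E =ᵐ[volume] Icc t (φ T) := by
    refine ae_eq_of_subset_of_measure_ge ?_ hvol.ge
      (hEm.image_of_continuousOn_injOn hcont.continuousOn hmono.injective.injOn).nullMeasurableSet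
      (by simp)
    rintro _ ⟨x, hx, rfl⟩
    exact ⟨by rw [← hφt]; exact hmono.monotone hx.1.1, hmono.monotone hx.1.2⟩
  have hderiv : ∀ x ∈ E, deriv z (φ x) = (g x)⁻¹ • deriv y x := fun x hx => by
    have h1 : HasDerivAt e.symm (g x)⁻¹ (φ x) :=
      HasDerivAt.of_local_left_inverse e.symm.continuous.continuousAt
        (by rw [he]; exact (hE x hx).1) (hgpos x).ne' (Eventually.of_forall he')
    have h2 : HasDerivAt y (deriv y x) (e.symm (φ x)) := by
      rw [he]; exact (hE x hx).2.hasDerivAt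
    exact (h2.scomp (φ x) h1).deriv
  calc ∫⁻ s in Icc t T, L s (z s) (deriv z s)
      = ∫⁻ s in Icc t T, (Icc t T).indicator (fun s => L s (z s) (deriv z s)) s :=
        setLIntegral_congr_fun measurableSet_Icc fun s hs => by
          simp only [indicator_of_mem hs]
    _ ≤ ∫⁻ s in Icc t (φ T), (Icc t T).indicator (fun s => L s (z s) (deriv z s)) s :=
        lintegral_mono_set (Icc_subset_Icc_right hT)
    _ = ∫⁻ s in Icc t T, ENNReal.ofReal (g s) *
          (Icc t T).indicator (fun s => L s (z s) (deriv z s)) (φ s) := by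
        rw [← setLIntegral_congr him, hcv]
    _ = ∫⁻ s in E, ENNReal.ofReal (g s) *
          (Icc t T).indicator (fun s => L s (z s) (deriv z s)) (φ s) :=
        (setLIntegral_congr hEae).symm
    _ ≤ ∫⁻ s in E, ENNReal.ofReal (g s) *
          L (min (φ s) T) (y s) ((g s)⁻¹ • deriv y s) := by
        -- Past T the left side vanishes; the minimum on the right only keeps the time argument in
        -- I.
        refine setLIntegral_mono' hEm fun s hs => mul_le_mul_right ?_ _
        by_cases h : φ s ∈ Icc t T
        · rw [indicator_of_mem h, hderiv s hs, min_eq_left h.2, hz, Function.comp_apply, he]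
        · rw [indicator_of_notMem h]; exact zero_le
    _ = _ := setLIntegral_congr hEae

end TimeChange

/-! ### Energy of the reparametrized trajectory -/

section Approximation

variable {n : ℕ} {p t T K : ℝ} {Λ : ℝ → Rn n → Rn n → ℝ≥0∞} {Ψ : ℝ → Rn n → ℝ≥0∞} {y : ℝ → Rn n}

/-- Regularity is assumed on I only; composing with the projection onto I gives globally measurable
functions with the same values on I. -/
lemma measurable_comp_projIcc (htT : t ≤ T) (hy : ContinuousOn y (Icc t T)) :
    Measurable fun s => y (projIcc t T htT s) :=
  (hy.domRestrict.comp continuous_projIcc).measurable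

lemma BasicAssumptions.aemeasurable_Ψ (h : BasicAssumptions t T Λ Ψ) (htT : t ≤ T)
    (hy : ContinuousOn y (Icc t T)) {τ : ℝ → ℝ} (hτm : Measurable τ)
    (hτ : ∀ s ∈ Icc t T, τ s ∈ Icc t T) :
    AEMeasurable (fun s => Ψ (τ s) (y s)) (volume.restrict (Icc t T)) := by
  have hm : Measurable fun s => Ψ (projIcc t T htT (τ s)) (y (projIcc t T htT s)) :=
    h.borel_Ψ.comp (Measurable.prodMk ((continuous_projIcc (h := htT)).measurable.comp hτm)
      (measurable_comp_projIcc htT hy))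
  refine hm.aemeasurable.congr ?_
  rw [EventuallyEq, ae_restrict_iff' measurableSet_Icc]
  exact Eventually.of_forall fun s hs => by
    simp only [projIcc_of_mem htT hs, projIcc_of_mem htT (hτ s hs)]

lemma BasicAssumptions.aemeasurable_Λ (h : BasicAssumptions t T Λ Ψ) (htT : t ≤ T)
    (hy : ContinuousOn y (Icc t T)) :
    AEMeasurable (fun s => Λ s (y s) (deriv y s)) (volume.restrict (Icc t T)) := by
  have hm : Measurable fun s =>
      Λ (projIcc t T htT s) (y (projIcc t T htT s)) (deriv y s) :=
    h.borel_Λ.comp (Measurable.prodMk (continuous_projIcc (h := htT)).measurable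
      (Measurable.prodMk (measurable_comp_projIcc htT hy) (measurable_deriv y)))
  refine hm.aemeasurable.congr ?_
  rw [EventuallyEq, ae_restrict_iff' measurableSet_Icc]
  exact Eventually.of_forall fun s hs => by simp only [projIcc_of_mem htT hs]

/-- The displacement is the integral of g - 1, which vanishes where g = 1; elsewhere |g - 1| ≤ g
because g ≥ 1/2. -/
lemma abs_timeChange_sub_self_le {g : ℝ → ℝ} (hgm : Measurable g) (hg : LocallyIntegrable g)
    (hcg : ∀ x, 1 / 2 ≤ g x) {η : ℝ} (hη : 0 ≤ η)
    (hle : ∫⁻ s in Icc t T ∩ {s | g s ≠ 1}, ENNReal.ofReal (g s) ≤ ENNReal.ofReal η)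
    {s : ℝ} (hs : s ∈ Icc t T) : |timeChange g t s - s| ≤ η := by
  have h1 : timeChange g t s - s = ∫ x in Ioc t s, (g x - 1) := by
    rw [← intervalIntegral.integral_of_le hs.1, intervalIntegral.integral_sub
      (intervalIntegrable_of_locallyIntegrable hg _ _) intervalIntegrable_const, timeChange]
    simp only [intervalIntegral.integral_const, smul_eq_mul, mul_one]
    ring
  rw [h1, ← Real.norm_eq_abs, ← ENNReal.ofReal_le_ofReal_iff hη, ofReal_norm]
  have hm : MeasurableSet {s | g s ≠ 1} := (hgm (measurableSet_singleton 1)).compl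
  calc ‖∫ x in Ioc t s, (g x - 1)‖ₑ ≤ ∫⁻ x in Ioc t s, ‖g x - 1‖ₑ :=
        enorm_integral_le_lintegral_enorm _
    _ ≤ ∫⁻ x in Icc t T, ‖g x - 1‖ₑ :=
        lintegral_mono_set fun x hx => ⟨hx.1.le, hx.2.trans hs.2⟩
    _ ≤ ∫⁻ x in Icc t T, {s | g s ≠ 1}.indicator (fun s => ENNReal.ofReal (g s)) x := by
        refine lintegral_mono fun x => ?_
        by_cases h : g x = 1
        · simp [h]
        · rw [indicator_of_mem h, ← ofReal_norm, Real.norm_eq_abs]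
          refine ENNReal.ofReal_le_ofReal (abs_le.2 ⟨?_, ?_⟩) <;> linarith [hcg x]
    _ = ∫⁻ s in Icc t T ∩ {s | g s ≠ 1}, ENNReal.ofReal (g s) := by
        rw [setLIntegral_indicator hm, inter_comm]
    _ ≤ _ := hle

lemma PPsi.lintegral_lt_top (hbasic : BasicAssumptions t T Λ Ψ) (htT : t ≤ T)
    (hP : PPsi t T Ψ K) (hy : ContinuousOn y (Icc t T)) (hyK : ∀ s ∈ Icc t T, ‖y s‖ ≤ K)
    (hfin : energy t T Λ Ψ y < ⊤) : ∫⁻ s in Icc t T, Λ s (y s) (deriv y s) < ⊤ := by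
  obtain ⟨m, hm, hmΨ⟩ := hP
  have h : (m : ℝ≥0∞) * ∫⁻ s in Icc t T, Λ s (y s) (deriv y s) ≤ energy t T Λ Ψ y := by
    rw [← lintegral_const_mul'' _ (hbasic.aemeasurable_Λ htT hy)]
    refine setLIntegral_mono' measurableSet_Icc fun s hs => ?_
    rw [mul_comm]
    exact mul_le_mul_right (hmΨ s hs _ (hyK s hs)) _
  exact ENNReal.lt_top_of_mul_ne_top_right (h.trans_lt hfin).ne (by simpa using hm.ne')

/-- An a.e. form of Condition (S) along a trajectory, with a single integrable weight. -/
lemma ConditionS.exists_weight (hS : ConditionS p t T Λ) (hp : 1 ≤ p)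
    (hbasic : BasicAssumptions t T Λ Ψ) (htT : t ≤ T) (hy : MemW1p p t T y)
    (hyK : ∀ s ∈ Icc t T, ‖y s‖ ≤ K) (hΛ : ∫⁻ s in Icc t T, Λ s (y s) (deriv y s) < ⊤) :
    ∃ ρ : ℝ → ℝ≥0∞, AEMeasurable ρ (volume.restrict (Icc t T)) ∧ ∫⁻ s in Icc t T, ρ s < ⊤ ∧
      ∃ ε > 0, ∀ᵐ s ∂(volume.restrict (Icc t T)), ∀ τ ∈ Icc t T, |τ - s| ≤ ε →
        Λ τ (y s) (deriv y s) ≤ Λ s (y s) (deriv y s) + ENNReal.ofReal |τ - s| * ρ s := by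
  have hK : 0 ≤ K := (norm_nonneg _).trans (hyK t (left_mem_Icc.2 htT))
  obtain ⟨D, hD⟩ := hbasic.dom_prod
  obtain ⟨κ, β, hκ, hβ, γ, hγ, ε, hε, hSae⟩ := hS K hK
  have hΛm := hbasic.aemeasurable_Λ htT
    (by simpa [uIcc_of_le htT] using hy.absCont.continuousOn)
  refine ⟨fun s => ENNReal.ofReal
    (κ * (Λ s (y s) (deriv y s)).toReal + β * ‖deriv y s‖ ^ p + γ s), ?_, ?_, ε, hε, ?_⟩
  · exact (((hΛm.ennreal_toReal.const_mul κ).add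
      (((measurable_deriv y).norm.pow_const p).const_mul β).aemeasurable).add
      hγ.aemeasurable).ennreal_ofReal
  · have hpow : IntegrableOn (fun s => ‖deriv y s‖ ^ p) (Icc t T) := by
      have := hy.memLp_deriv.integrable_norm_rpow
        (by simpa using zero_lt_one.trans_le hp) ENNReal.ofReal_ne_top
      rwa [ENNReal.toReal_ofReal (zero_le_one.trans hp)] at this
    exact ((((integrable_toReal_of_lintegral_ne_top hΛm hΛ.ne).const_mul κ).add
      (hpow.const_mul β)).add hγ).lintegral_lt_top
  · filter_upwards [hSae, ae_lt_top' hΛm hΛ.ne, ae_restrict_mem measurableSet_Icc]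
      with s hs hfin hsI τ hτ hτs
    have hmem : τ ∈ Icc (s - ε) (s + ε) := by
      rw [abs_le] at hτs
      constructor <;> linarith
    -- The product form of the effective domain carries finiteness from time s to time τ, so the
    -- real-valued inequality of (S) transfers to [0, ∞].
    have hfinτ : Λ τ (y s) (deriv y s) < ⊤ := (hD τ hτ _ _).2 ((hD s hsI _ _).1 hfin)
    have h := (abs_le.1 (hs s ⟨⟨by linarith, by linarith⟩, hsI⟩ τ ⟨hmem, hτ⟩ _ _
      (hyK s hsI) hfin)).2
    rw [← ENNReal.ofReal_mul (abs_nonneg _), ← ENNReal.ofReal_toReal hfinτ.ne]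
    conv_rhs => enter [1]; rw [← ENNReal.ofReal_toReal hfin.ne]
    refine le_trans (ENNReal.ofReal_le_ofReal ?_) ENNReal.ofReal_add_le
    linarith

/-- Sequences of time changes with small slowed-down part lead to Lipschitz trajectories of almost
the same energy. -/
lemma exists_lipschitz_energy_le_of_density (hp : 1 ≤ p) (htT : t < T)
    (hbasic : BasicAssumptions t T Λ Ψ) (hS : ConditionS p t T Λ) {r : ℝ}
    (hB : BPsi t T Ψ K) (hC : CPsi t T Ψ K) (hP : PPsi t T Ψ K) (hΛ : BoundedOn t T Λ K r)
    (hy : MemW1p p t T y) (hyK : ∀ s ∈ Icc t T, ‖y s‖ ≤ K) (hfin : energy t T Λ Ψ y < ⊤)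
    {e : Prop}
    (hg : ∀ η : ℝ, 0 < η → ∃ g : ℝ → ℝ, Measurable g ∧ LocallyIntegrable g ∧
      (∀ x, 1 / 2 ≤ g x) ∧ T ≤ timeChange g t T ∧ (e → timeChange g t T = T) ∧
      (∃ C : ℝ≥0, ∀ s ∈ Icc t T, ‖deriv y s‖ ≤ C * g s) ∧
      (∀ s ∈ Icc t T, g s = 1 ∨ ‖deriv y s‖ ≤ r * g s) ∧
      ∫⁻ s in Icc t T ∩ {s | g s ≠ 1}, ENNReal.ofReal (g s) ≤ ENNReal.ofReal η)
    {δ : ℝ≥0∞} (hδ : 0 < δ) :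
    ∃ z ∈ Lip (n := n) t T, z t = y t ∧ (e → z T = y T) ∧
      energy t T Λ Ψ z ≤ energy t T Λ Ψ y + δ := by
  have hyc : ContinuousOn y (Icc t T) := by
    simpa [uIcc_of_le htT.le] using hy.absCont.continuousOn
  have hΛint := hP.lintegral_lt_top hbasic htT.le hyc hyK hfin
  obtain ⟨ρ, hρm, hρ, ε, hε, hSρ⟩ := hS.exists_weight hp hbasic htT.le hy hyK hΛint
  obtain ⟨MΨ, hMΨ⟩ := hB
  obtain ⟨M, hM⟩ := hΛ
  set η : ℕ → ℝ := fun k => 1 / ((k : ℝ) + 1) with hη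
  have hηpos : ∀ k, 0 < η k := fun k => Nat.one_div_pos_of_nat
  have hη0 : Tendsto η atTop (𝓝 0) := tendsto_one_div_add_atTop_nhds_zero_nat
  choose g hgm hgl hg2 hgT hge hgC hgr hgη using fun k => hg (η k) (hηpos k)
  set τ : ℕ → ℝ → ℝ := fun k s => min (timeChange (g k) t s) T with hτ
  have hτmem : ∀ k, ∀ s ∈ Icc t T, τ k s ∈ Icc t T := fun k s hs => by
    refine ⟨le_min ?_ htT.le, min_le_right _ _⟩
    have := (strictMono_timeChange (hgl k) one_half_pos (hg2 k) t).monotone hs.1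
    rwa [timeChange_self] at this
  have hτs : ∀ k, ∀ s ∈ Icc t T, |τ k s - s| ≤ η k := fun k s hs => by
    have h := abs_le.1 (abs_timeChange_sub_self_le (hgm k) (hgl k) (hg2 k) (hηpos k).le (hgη k) hs)
    refine abs_le.2 ⟨?_, ?_⟩
    · rw [neg_le_sub_iff_le_add]
      rcases min_cases (timeChange (g k) t s) T with h' | h' <;> simp only [hτ, h'.1] <;>
        linarith [hs.2, hηpos k]
    · have := min_le_left (timeChange (g k) t s) T
      simp only [hτ]
      linarith
  have hτm : ∀ k, Measurable (τ k) := fun k =>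
    ((continuous_timeChange (hgl k) t).min continuous_const).measurable
  have hΨτm := fun k => hbasic.aemeasurable_Ψ htT.le hyc (hτm k) (hτmem k)
  have hΛm := hbasic.aemeasurable_Λ htT.le hyc
  -- the energy of `y` with the time of `Ψ` shifted
  set A : ℕ → ℝ≥0∞ := fun k => ∫⁻ s in Icc t T, Λ s (y s) (deriv y s) * Ψ (τ k s) (y s) with hA
  -- Dominated by `MΨ` times Λ(s, y, y'), which is integrable because Ψ is bounded below; the
  -- pointwise limit is continuity of Ψ(·, y(s)).
  have hAlim : Tendsto A atTop (𝓝 (energy t T Λ Ψ y)) := by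
    refine tendsto_lintegral_of_dominated_convergence' (fun s => Λ s (y s) (deriv y s) * MΨ)
      (fun k => hΛm.mul (hΨτm k)) (fun k => ?_) ?_ ?_
    · rw [EventuallyLE, ae_restrict_iff' measurableSet_Icc]
      exact Eventually.of_forall fun s hs =>
        mul_le_mul_right (hMΨ _ (hτmem k s hs) _ (hyK s hs)) _
    · rw [lintegral_mul_const'' _ hΛm]
      exact ENNReal.mul_ne_top hΛint.ne ENNReal.coe_ne_top
    · filter_upwards [ae_lt_top' hΛm hΛint.ne, ae_restrict_mem measurableSet_Icc] with s hs hsI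
      refine ENNReal.Tendsto.const_mul ?_ (Or.inr hs.ne)
      refine ((hC _ (hyK s hsI)) s hsI).tendsto.comp
        (tendsto_nhdsWithin_iff.2 ⟨?_, Eventually.of_forall fun k => hτmem k s hsI⟩)
      rw [tendsto_iff_dist_tendsto_zero]
      exact squeeze_zero (fun _ => dist_nonneg) (fun k => hτs k s hsI) hη0
  -- The three terms are the part where g ≠ 1, the part with only the time of Ψ shifted, and the
  -- error from Condition (S).
  have key : ∀ k, η k ≤ ε → ∃ z ∈ Lip (n := n) t T, z t = y t ∧ (e → z T = y T) ∧
      energy t T Λ Ψ z ≤ M * MΨ * ENNReal.ofReal (η k) +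
        (A k + ENNReal.ofReal (η k) * (MΨ * ∫⁻ s in Icc t T, ρ s)) := by
    intro k hk
    obtain ⟨C, hCk⟩ := hgC k
    obtain ⟨z, hz, hzt, hzT, hzL⟩ := exists_lipschitz_reparametrization htT.le hy.absCont
      (hy.integrableOn_deriv hp) (hgl k) one_half_pos (hg2 k) (hgT k) hCk
    refine ⟨z, ⟨C, hz⟩, hzt, fun he => hzT (hge k he), ?_⟩
    refine (hzL fun s x v => Λ s x v * Ψ s x).trans ?_
    have hgm' : MeasurableSet {s | g k s ≠ 1} := (hgm k (measurableSet_singleton 1)).compl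
    have hpt : ∀ᵐ s ∂(volume.restrict (Icc t T)), ENNReal.ofReal (g k s) *
        (Λ (τ k s) (y s) ((g k s)⁻¹ • deriv y s) * Ψ (τ k s) (y s)) ≤
        {s | g k s ≠ 1}.indicator (fun s => M * MΨ * ENNReal.ofReal (g k s)) s +
        (Λ s (y s) (deriv y s) * Ψ (τ k s) (y s) + ENNReal.ofReal (η k) * (MΨ * ρ s)) := by
      filter_upwards [hSρ, ae_restrict_mem measurableSet_Icc] with s hs hsI
      have hΨs := hMΨ _ (hτmem k s hsI) _ (hyK s hsI)
      by_cases h1 : g k s = 1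
      · rw [indicator_of_notMem (by simpa using h1), h1]
        simp only [ENNReal.ofReal_one, one_mul, inv_one, one_smul, zero_add]
        calc _ ≤ (Λ s (y s) (deriv y s) + ENNReal.ofReal (η k) * ρ s) * Ψ (τ k s) (y s) := by
              refine mul_le_mul_left ((hs _ (hτmem k s hsI) ((hτs k s hsI).trans hk)).trans ?_) _
              gcongr
              exact hτs k s hsI
          _ ≤ _ := by
              rw [add_mul, mul_assoc, mul_comm (ρ s)]
              gcongr
      · rw [indicator_of_mem h1]
        refine le_add_right ?_
        rw [mul_comm]
        refine mul_le_mul_left (mul_le_mul' (hM _ (hτmem k s hsI) _ _ (hyK s hsI) ?_) hΨs) _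
        have hpos : 0 < g k s := one_half_pos.trans_le (hg2 k s)
        rw [norm_smul, norm_inv, Real.norm_of_nonneg hpos.le, inv_mul_le_iff₀ hpos, mul_comm]
        exact (hgr k s hsI).resolve_left h1
    refine (lintegral_mono_ae hpt).trans ?_
    rw [lintegral_add_left (((hgm k).ennreal_ofReal.const_mul _).indicator hgm'),
      lintegral_add_left' (f := fun s => Λ s (y s) (deriv y s) * Ψ (τ k s) (y s))
        (hΛm.mul (hΨτm k)), lintegral_const_mul'' _ (hρm.const_mul _),
      lintegral_const_mul'' _ hρm, setLIntegral_indicator hgm',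
      lintegral_const_mul _ (hgm k).ennreal_ofReal, inter_comm]
    gcongr
    exact hgη k
  have hη0' : Tendsto (fun k => ENNReal.ofReal (η k)) atTop (𝓝 0) := by
    simpa using ENNReal.tendsto_ofReal hη0
  have hlim : Tendsto (fun k => M * MΨ * ENNReal.ofReal (η k) +
        (A k + ENNReal.ofReal (η k) * (MΨ * ∫⁻ s in Icc t T, ρ s))) atTop
      (𝓝 (energy t T Λ Ψ y)) := by
    have h1 := ENNReal.Tendsto.const_mul (a := M * MΨ) hη0'
      (Or.inr (ENNReal.mul_ne_top ENNReal.coe_ne_top ENNReal.coe_ne_top))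
    have h2 := ENNReal.Tendsto.mul_const (b := MΨ * ∫⁻ s in Icc t T, ρ s) hη0'
      (Or.inr (ENNReal.mul_ne_top ENNReal.coe_ne_top hρ.ne))
    simpa using h1.add (hAlim.add h2)
  have hlt : energy t T Λ Ψ y < energy t T Λ Ψ y + δ := ENNReal.lt_add_right hfin.ne hδ.ne'
  obtain ⟨k, hk1, hk2⟩ := ((hlim.eventually (gt_mem_nhds hlt)).and
    (hη0.eventually (ge_mem_nhds hε))).exists
  obtain ⟨z, hz, hzt, hzT, hzE⟩ := key k hk2
  exact ⟨z, hz, hzt, hzT, hzE.trans hk1.le⟩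

end Approximation

/-! ### Construction of the density -/

section Density

variable {n : ℕ} {t T R ν : ℝ} {y : ℝ → Rn n}

lemma exists_forall_setLIntegral_norm_le {f : ℝ → Rn n} {s : Set ℝ} (hf : IntegrableOn f s)
    (hfm : Measurable f) {η : ℝ} (hη : 0 < η) :
    ∃ M : ℝ, ∀ ν, M ≤ ν →
      ∫⁻ x in s ∩ {x | ν < ‖f x‖}, ENNReal.ofReal ‖f x‖ ≤ ENNReal.ofReal η := by
  obtain ⟨M, -, hM⟩ := (memLp_one_iff_integrable.2 hf).integral_indicator_norm_ge_nonneg_le hη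
  refine ⟨M, fun ν hν => le_trans ?_ hM⟩
  have hm : MeasurableSet {x | ν < ‖f x‖} := measurableSet_lt measurable_const hfm.norm
  rw [inter_comm, ← setLIntegral_indicator hm]
  refine lintegral_mono fun x => ?_
  by_cases hx : ν < ‖f x‖
  · rw [indicator_of_mem (show x ∈ {x | ν < ‖f x‖} from hx),
      indicator_of_mem (show x ∈ {x | M ≤ ‖f x‖₊} from hν.trans hx.le), ofReal_norm]
  · rw [indicator_of_notMem (show x ∉ {x | ν < ‖f x‖} from hx)]
    exact zero_le

/-- Intermediate value theorem for τ ↦ |A ∩ (t, τ]|. -/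
lemma exists_subset_volume_real_eq (htT : t ≤ T) {A : Set ℝ} (hA : MeasurableSet A)
    (hAI : A ⊆ Icc t T) {c : ℝ} (hc : 0 ≤ c) (hcA : c ≤ volume.real A) :
    ∃ B ⊆ A, MeasurableSet B ∧ volume.real B = c := by
  have hint : ∀ a b, IntervalIntegrable (A.indicator (1 : ℝ → ℝ)) volume a b := fun a b =>
    (((locallyIntegrable_const (1 : ℝ)).integrableOn_isCompact isCompact_uIcc).indicator
      hA).intervalIntegrable
  have hf : ∀ τ, t ≤ τ → ∫ x in t..τ, A.indicator (1 : ℝ → ℝ) x = volume.real (A ∩ Ioc t τ) :=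
    fun τ hτ => by
      rw [intervalIntegral.integral_of_le hτ, integral_indicator_one hA,
        measureReal_restrict_apply hA]
  have hAT : volume.real (A ∩ Ioc t T) = volume.real A := by
    refine measureReal_congr ?_
    have : (A ∩ Ioc t T : Set ℝ) =ᵐ[volume] (A ∩ Icc t T : Set ℝ) :=
      (ae_eq_refl A).inter Ioc_ae_eq_Icc
    rwa [inter_eq_left.2 hAI] at this
  have hcont := (intervalIntegral.continuous_primitive hint t).continuousOn (s := Icc t T)
  obtain ⟨τ, hτ, hτc⟩ := intermediate_value_Icc htT hcont
    (show c ∈ _ from ⟨by simpa using hc, by rwa [hf T htT, hAT]⟩)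
  exact ⟨A ∩ Ioc t τ, inter_subset_left, hA.inter measurableSet_Ioc, (hf τ hτ.1).symm.trans hτc⟩

/-- The set of times in `[t, T]` at which the speed of `y` exceeds `ν`. -/
def fastSet (t T ν : ℝ) (y : ℝ → Rn n) : Set ℝ := Icc t T ∩ {s | ν < ‖deriv y s‖}

/-- The density of the change of time that reduces the speed of `y` to `R` on `fastSet t T ν y` and
doubles it on `B`. -/
noncomputable def density (t T R ν : ℝ) (y : ℝ → Rn n) (B : Set ℝ) (s : ℝ) : ℝ :=
  1 + (fastSet t T ν y).indicator (fun s => ‖deriv y s‖ / R - 1) s -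
    B.indicator (fun _ => 1 / 2) s

lemma measurableSet_fastSet (t T ν : ℝ) (y : ℝ → Rn n) : MeasurableSet (fastSet t T ν y) :=
  measurableSet_Icc.inter (measurableSet_lt measurable_const (measurable_deriv y).norm)

lemma density_of_mem_fastSet {B : Set ℝ} (hB : B ⊆ Icc t T ∩ {s | ‖deriv y s‖ ≤ R})
    (hRν : R ≤ ν) {s : ℝ} (hs : s ∈ fastSet t T ν y) :
    density t T R ν y B s = ‖deriv y s‖ / R := by
  have hsB : s ∉ B := fun h => by
    have h1 : ‖deriv y s‖ ≤ R := (hB h).2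
    have h2 : ν < ‖deriv y s‖ := hs.2
    linarith
  simp [density, hs, hsB]

lemma density_of_mem {B : Set ℝ} (hB : B ⊆ Icc t T ∩ {s | ‖deriv y s‖ ≤ R})
    (hRν : R ≤ ν) {s : ℝ} (hs : s ∈ B) : density t T R ν y B s = 1 / 2 := by
  have hsS : s ∉ fastSet t T ν y := fun h => by
    have h1 : ‖deriv y s‖ ≤ R := (hB hs).2
    have h2 : ν < ‖deriv y s‖ := h.2
    linarith
  simp only [density, hs, hsS, not_false_eq_true, indicator_of_notMem, indicator_of_mem]
  norm_num

lemma density_of_notMem {B : Set ℝ} {s : ℝ} (hs : s ∉ fastSet t T ν y) (hsB : s ∉ B) :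
    density t T R ν y B s = 1 := by
  simp [density, hs, hsB]

lemma measurable_density {B : Set ℝ} (hBm : MeasurableSet B) :
    Measurable (density t T R ν y B) :=
  (measurable_const.add ((((measurable_deriv y).norm.div_const R).sub_const 1).indicator
    (measurableSet_fastSet t T ν y))).sub (measurable_const.indicator hBm)

lemma integrable_fastSet_indicator (hyi : IntegrableOn (deriv y) (Icc t T)) :
    Integrable ((fastSet t T ν y).indicator fun s => ‖deriv y s‖ / R - 1) := by
  refine IntegrableOn.integrable_indicator ?_ (measurableSet_fastSet t T ν y)
  have h : IntegrableOn (fun s => ‖deriv y s‖ / R - 1) (Icc t T) :=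
    (hyi.norm.div_const R).sub (integrableOn_const (by simp))
  exact h.mono_set inter_subset_left

lemma integrable_indicator_half {B : Set ℝ} (hBm : MeasurableSet B) (hB : B ⊆ Icc t T) :
    Integrable (B.indicator fun _ => (1 / 2 : ℝ)) :=
  IntegrableOn.integrable_indicator
    (integrableOn_const ((measure_mono hB).trans_lt measure_Icc_lt_top).ne) hBm

lemma locallyIntegrable_density (hyi : IntegrableOn (deriv y) (Icc t T)) {B : Set ℝ}
    (hBm : MeasurableSet B) (hB : B ⊆ Icc t T) : LocallyIntegrable (density t T R ν y B) :=
  ((locallyIntegrable_const 1).add (integrable_fastSet_indicator hyi).locallyIntegrable).sub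
    (integrable_indicator_half hBm hB).locallyIntegrable

lemma half_le_density {B : Set ℝ} (hR : 0 < R) (hRν : R ≤ ν)
    (hB : B ⊆ Icc t T ∩ {s | ‖deriv y s‖ ≤ R}) (s : ℝ) : 1 / 2 ≤ density t T R ν y B s := by
  by_cases hs : s ∈ fastSet t T ν y
  · rw [density_of_mem_fastSet hB hRν hs]
    have h2 : ν < ‖deriv y s‖ := hs.2
    have : 1 ≤ ‖deriv y s‖ / R := by rw [one_le_div hR]; linarith
    linarith
  · by_cases hsB : s ∈ B
    · rw [density_of_mem hB hRν hsB]
    · rw [density_of_notMem hs hsB]; norm_num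

/-- The endpoint T is preserved exactly when |B| is twice the excess integral over the fast set. -/
lemma timeChange_density (htT : t ≤ T) (hyi : IntegrableOn (deriv y) (Icc t T)) {B : Set ℝ}
    (hBm : MeasurableSet B) (hB : B ⊆ Icc t T) :
    timeChange (density t T R ν y B) t T =
      T + (∫ s in fastSet t T ν y, (‖deriv y s‖ / R - 1)) - volume.real B / 2 := by
  have h1 := (integrable_fastSet_indicator (R := R) (ν := ν) hyi)
  have h2 := integrable_indicator_half hBm hB
  have hadd : ∫ x in t..T, density t T R ν y B x =
      (∫ x in t..T, (1 + (fastSet t T ν y).indicator (fun s => ‖deriv y s‖ / R - 1) x)) -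
        ∫ x in t..T, B.indicator (fun _ => (1 / 2 : ℝ)) x :=
    intervalIntegral.integral_sub (intervalIntegrable_const.add h1.intervalIntegrable)
      h2.intervalIntegrable
  have hS : fastSet t T ν y ⊆ Icc t T := inter_subset_left
  rw [timeChange, hadd, intervalIntegral.integral_add intervalIntegrable_const
    h1.intervalIntegrable, intervalIntegral.integral_of_le htT (f := Set.indicator _ _),
    intervalIntegral.integral_of_le htT (f := Set.indicator _ _),
    ← integral_Icc_eq_integral_Ioc, ← integral_Icc_eq_integral_Ioc,
    setIntegral_indicator (measurableSet_fastSet t T ν y), setIntegral_indicator hBm,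
    inter_eq_right.2 hS, inter_eq_right.2 hB]
  simp
  ring

lemma setLIntegral_density_le {B : Set ℝ} (hRν : R ≤ ν) (hBm : MeasurableSet B)
    (hB : B ⊆ Icc t T ∩ {s | ‖deriv y s‖ ≤ R}) :
    ∫⁻ s in Icc t T ∩ {s | density t T R ν y B s ≠ 1}, ENNReal.ofReal (density t T R ν y B s) ≤
      (∫⁻ s in fastSet t T ν y, ENNReal.ofReal (‖deriv y s‖ / R)) +
        ENNReal.ofReal (volume.real B / 2) := by
  have hsub : Icc t T ∩ {s | density t T R ν y B s ≠ 1} ⊆ fastSet t T ν y ∪ B := fun s hs => by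
    by_contra h
    rw [mem_union, not_or] at h
    exact hs.2 (density_of_notMem h.1 h.2)
  have hBfin : volume B ≠ ⊤ :=
    ((measure_mono (hB.trans inter_subset_left)).trans_lt measure_Icc_lt_top).ne
  refine (lintegral_mono_set hsub).trans ((lintegral_union_le _ _ _).trans ?_)
  have h1 : ∫⁻ s in fastSet t T ν y, ENNReal.ofReal (density t T R ν y B s) =
      ∫⁻ s in fastSet t T ν y, ENNReal.ofReal (‖deriv y s‖ / R) :=
    setLIntegral_congr_fun (measurableSet_fastSet t T ν y) fun s hs => by
      simp only [density_of_mem_fastSet hB hRν hs]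
  have h2 : ∫⁻ s in B, ENNReal.ofReal (density t T R ν y B s) =
      ∫⁻ _ in B, ENNReal.ofReal (1 / 2) :=
    setLIntegral_congr_fun hBm fun s hs => by simp only [density_of_mem hB hRν hs]
  rw [h1, h2]
  refine add_le_add_right (le_of_eq ?_) _
  rw [setLIntegral_const, div_eq_inv_mul (volume.real B), ENNReal.ofReal_mul (by norm_num),
    measureReal_def, ENNReal.ofReal_toReal hBfin, one_div]

/-- Densities with small slowed-down part; if `{|y'| ≤ R}` is not negligible, the change of time
can be chosen to preserve the interval. -/
lemma exists_density (htT : t ≤ T) (hyi : IntegrableOn (deriv y) (Icc t T)) (hR : 0 < R)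
    {e : Prop} (he : e → 0 < volume.real (Icc t T ∩ {s | ‖deriv y s‖ ≤ R})) {η : ℝ} (hη : 0 < η) :
    ∃ g : ℝ → ℝ, Measurable g ∧ LocallyIntegrable g ∧
      (∀ x, 1 / 2 ≤ g x) ∧ T ≤ timeChange g t T ∧ (e → timeChange g t T = T) ∧
      (∃ C : ℝ≥0, ∀ s ∈ Icc t T, ‖deriv y s‖ ≤ C * g s) ∧
      (∀ s ∈ Icc t T, g s = 1 ∨ ‖deriv y s‖ ≤ 2 * R * g s) ∧
      ∫⁻ s in Icc t T ∩ {s | g s ≠ 1}, ENNReal.ofReal (g s) ≤ ENNReal.ofReal η := by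
  set A := Icc t T ∩ {s | ‖deriv y s‖ ≤ R} with hA
  have hAm : MeasurableSet A :=
    measurableSet_Icc.inter (measurableSet_le (measurable_deriv y).norm measurable_const)
  -- The fast set and B will each cost at most η', hence 2η' ≤ η; B will have measure at most 2η',
  -- hence 2η' ≤ |A| if B has to fit in A.
  obtain ⟨η', hη', hη'η, hη'A⟩ : ∃ η' > 0, 2 * η' ≤ η ∧ (e → 2 * η' ≤ volume.real A) := by
    by_cases h : e
    · refine ⟨min η (volume.real A) / 2, half_pos (lt_min hη (he h)), ?_, fun _ => ?_⟩
      · linarith [min_le_left η (volume.real A)]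
      · linarith [min_le_right η (volume.real A)]
    · exact ⟨η / 2, half_pos hη, by linarith, fun h' => absurd h' h⟩
  obtain ⟨M, hM⟩ := exists_forall_setLIntegral_norm_le hyi (measurable_deriv y)
    (mul_pos hR hη')
  -- ν ≥ R makes the fast set disjoint from B and gives g ≥ 1 on it.
  set ν := max M R with hν
  have hRν : R ≤ ν := le_max_right _ _
  have hSm := measurableSet_fastSet t T ν y
  have hJ : ∫⁻ s in fastSet t T ν y, ENNReal.ofReal (‖deriv y s‖ / R) ≤ ENNReal.ofReal η' := by
    have h := hM ν (le_max_left _ _)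
    simp only [div_eq_inv_mul, ENNReal.ofReal_mul (inv_nonneg.2 hR.le)]
    rw [lintegral_const_mul _ (measurable_deriv y).norm.ennreal_ofReal]
    refine (mul_le_mul_right h _).trans_eq ?_
    rw [← ENNReal.ofReal_mul (inv_nonneg.2 hR.le), inv_mul_cancel_left₀ hR.ne']
  have hexn : ∀ s ∈ fastSet t T ν y, 0 ≤ ‖deriv y s‖ / R - 1 := fun s hs => by
    have h2 : ν < ‖deriv y s‖ := hs.2
    have : 1 ≤ ‖deriv y s‖ / R := by rw [one_le_div hR]; linarith
    linarith
  set E := ∫ s in fastSet t T ν y, (‖deriv y s‖ / R - 1) with hE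
  have hE0 : 0 ≤ E := setIntegral_nonneg hSm hexn
  have hEη : E ≤ η' := by
    rw [← ENNReal.ofReal_le_ofReal_iff hη'.le, hE, ofReal_integral_eq_lintegral_ofReal
      ((integrable_indicator_iff hSm).1 (integrable_fastSet_indicator hyi))
      ((ae_restrict_iff' hSm).2 (Eventually.of_forall hexn))]
    refine le_trans (lintegral_mono fun s => ENNReal.ofReal_le_ofReal ?_) hJ
    linarith
  obtain ⟨B, hBA, hBm, hBE, hBe⟩ : ∃ B ⊆ A, MeasurableSet B ∧ volume.real B ≤ 2 * E ∧
      (e → volume.real B = 2 * E) := by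
    by_cases h : e
    · obtain ⟨B, hBA, hBm, hB⟩ := exists_subset_volume_real_eq htT hAm inter_subset_left
        (c := 2 * E) (by linarith) (by linarith [hη'A h])
      exact ⟨B, hBA, hBm, hB.le, fun _ => hB⟩
    · exact ⟨∅, empty_subset _, MeasurableSet.empty, by simpa using hE0, fun h' => absurd h' h⟩
  have hBI : B ⊆ Icc t T := hBA.trans inter_subset_left
  have hφ := timeChange_density (R := R) (ν := ν) htT hyi hBm hBI
  rw [← hE] at hφ
  have hhalf := half_le_density hR hRν hBA
  -- C = 2ν works: off the fast set |y'| ≤ ν and g ≥ 1/2, and on it |y'| = R g.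
  refine ⟨density t T R ν y B, measurable_density hBm, locallyIntegrable_density hyi hBm hBI,
    hhalf, by linarith, fun h => by linarith [hBe h], ⟨⟨2 * ν, by linarith⟩, fun s hs => ?_⟩,
    fun s hs => ?_, ?_⟩
  · change ‖deriv y s‖ ≤ 2 * ν * density t T R ν y B s
    by_cases hsS : s ∈ fastSet t T ν y
    · rw [density_of_mem_fastSet hBA hRν hsS, mul_div_assoc', le_div_iff₀ hR, mul_comm]
      exact mul_le_mul_of_nonneg_right (by linarith) (norm_nonneg _)
    · have h1 : ‖deriv y s‖ ≤ ν := not_lt.1 fun h => hsS ⟨hs, h⟩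
      have h2 := mul_le_mul_of_nonneg_left (hhalf s) (show 0 ≤ 2 * ν by linarith)
      linarith
  · by_cases hsS : s ∈ fastSet t T ν y
    · right
      rw [density_of_mem_fastSet hBA hRν hsS, mul_assoc, mul_div_cancel₀ _ hR.ne']
      linarith [norm_nonneg (deriv y s)]
    · by_cases hsB : s ∈ B
      · right
        rw [density_of_mem hBA hRν hsB]
        have : ‖deriv y s‖ ≤ R := (hBA hsB).2
        linarith
      · exact Or.inl (density_of_notMem hsS hsB)
  · refine (setLIntegral_density_le hRν hBm hBA).trans ((add_le_add_left hJ _).trans ?_)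
    rw [← ENNReal.ofReal_add hη'.le (by positivity)]
    exact ENNReal.ofReal_le_ofReal (by linarith)

/-- The sets {|y'| ≤ k + 1} exhaust I, so they cannot all be null. -/
lemma exists_volume_real_norm_deriv_le_pos (htT : t < T) (y : ℝ → Rn n) :
    ∃ R > 0, 0 < volume.real (Icc t T ∩ {s | ‖deriv y s‖ ≤ R}) := by
  by_contra! h
  have h0 : ∀ k : ℕ, volume (Icc t T ∩ {s | ‖deriv y s‖ ≤ (k : ℝ) + 1}) = 0 := fun k => by
    have := le_antisymm (h (k + 1) (by positivity)) measureReal_nonneg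
    exact (measureReal_eq_zero_iff
      ((measure_mono inter_subset_left).trans_lt measure_Icc_lt_top).ne).1 this
  have h1 := measure_iUnion_null h0
  have h2 : Icc t T ⊆ ⋃ k : ℕ, Icc t T ∩ {s | ‖deriv y s‖ ≤ (k : ℝ) + 1} := fun s hs => by
    obtain ⟨k, hk⟩ := exists_nat_ge ‖deriv y s‖
    exact mem_iUnion.2 ⟨k, hs, show ‖deriv y s‖ ≤ (k : ℝ) + 1 by linarith⟩
  have h3 := measure_mono_null h2 h1
  rw [Real.volume_Icc, ENNReal.ofReal_eq_zero] at h3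
  linarith

end Density

/-! ### The minimization problems and the threshold -/

section Problems

variable {n : ℕ} {p t T K : ℝ} {Λ : ℝ → Rn n → Rn n → ℝ≥0∞} {Ψ : ℝ → Rn n → ℝ≥0∞} {y : ℝ → Rn n}
  {X Y : Rn n}

/-- Only trajectories of energy below a cutoff `c` above the infimum need approximation; `c = ⊤`
also covers an infinite infimum. -/
lemma noLavrentiev_of_forall_exists {Γ : Set (ℝ → Rn n)} {c : ℝ≥0∞}
    (hc : infEnergy t T Λ Ψ Γ < c ∨ c = ⊤)
    (h : ∀ y ∈ Γ, energy t T Λ Ψ y < c → ∀ δ : ℝ≥0∞, 0 < δ →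
      ∃ z ∈ Γ ∩ Lip t T, energy t T Λ Ψ z ≤ energy t T Λ Ψ y + δ) :
    NoLavrentiev t T Λ Ψ Γ := by
  refine le_antisymm (biInf_mono inter_subset_left) (le_of_forall_gt fun a ha => ?_)
  have hac : infEnergy t T Λ Ψ Γ < min a c := by
    rcases hc with hc | rfl
    · exact lt_min ha hc
    · simpa using ha
  obtain ⟨y, hy, hyE⟩ : ∃ y ∈ Γ, energy t T Λ Ψ y < min a c := by
    simpa only [infEnergy, iInf_lt_iff, exists_prop] using hac
  obtain ⟨δ, hδ, hδa⟩ := ENNReal.lt_iff_exists_add_pos_lt.1 (hyE.trans_le (min_le_left _ _))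
  obtain ⟨z, hz, hzE⟩ := h y hy (hyE.trans_le (min_le_right _ _)) δ (by exact_mod_cast hδ)
  exact (iInf₂_le z hz).trans_lt (hzE.trans_lt hδa)

lemma exists_lipschitz_mem_Gamma₁ (hp : 1 ≤ p) (htT : t < T)
    (hbasic : BasicAssumptions t T Λ Ψ) (hS : ConditionS p t T Λ)
    (hB : BPsi t T Ψ K) (hC : CPsi t T Ψ K) (hP : PPsi t T Ψ K) (hΛ : BLambda t T Λ K)
    (hy : y ∈ Gamma₁ p t T X) (hyK : ∀ s ∈ Icc t T, ‖y s‖ ≤ K) (hfin : energy t T Λ Ψ y < ⊤)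
    {δ : ℝ≥0∞} (hδ : 0 < δ) :
    ∃ z ∈ Gamma₁ p t T X ∩ Lip t T, energy t T Λ Ψ z ≤ energy t T Λ Ψ y + δ := by
  obtain ⟨ν₀, hν₀, hΛ⟩ := hΛ
  obtain ⟨z, hz, hzt, -, hzE⟩ := exists_lipschitz_energy_le_of_density hp htT hbasic hS hB hC hP
    -- R = ν₀/2, so that the new speeds 2R stay in the ball where Λ is bounded.
    (r := 2 * (ν₀ / 2)) (by rwa [mul_div_cancel₀ _ (two_ne_zero' ℝ)]) hy.1 hyK hfin (e := False)
    (fun η hη => exists_density htT.le (hy.1.integrableOn_deriv hp) (half_pos hν₀) False.elim hη) hδ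
  exact ⟨z, ⟨⟨memW1p_of_lipschitzOnWith htT hz.choose_spec, hzt.trans hy.2⟩, hz⟩, hzE⟩

lemma exists_lipschitz_mem_Gamma₂ (hp : 1 ≤ p) (htT : t < T)
    (hbasic : BasicAssumptions t T Λ Ψ) (hS : ConditionS p t T Λ)
    (hB : BPsi t T Ψ K) (hC : CPsi t T Ψ K) (hP : PPsi t T Ψ K) (hΛ : ULambda t T Λ K)
    (hy : y ∈ Gamma₂ p t T X Y) (hyK : ∀ s ∈ Icc t T, ‖y s‖ ≤ K) (hfin : energy t T Λ Ψ y < ⊤)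
    {δ : ℝ≥0∞} (hδ : 0 < δ) :
    ∃ z ∈ Gamma₂ p t T X Y ∩ Lip t T, energy t T Λ Ψ z ≤ energy t T Λ Ψ y + δ := by
  obtain ⟨R, hR, hRpos⟩ := exists_volume_real_norm_deriv_le_pos htT y
  obtain ⟨z, hz, hzt, hzT, hzE⟩ := exists_lipschitz_energy_le_of_density hp htT hbasic hS hB hC hP
    (hΛ (2 * R) (by positivity)) hy.1 hyK hfin (e := True)
    (fun η hη => exists_density htT.le (hy.1.integrableOn_deriv hp) hR (fun _ => hRpos) hη) hδ
  exact ⟨z, ⟨⟨memW1p_of_lipschitzOnWith htT hz.choose_spec, hzt.trans hy.2.1,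
    (hzT trivial).trans hy.2.2⟩, hz⟩, hzE⟩

lemma MemW1p.exists_norm_le (hy : MemW1p p t T y) (htT : t ≤ T) :
    ∃ K > 0, ∀ s ∈ Icc t T, ‖y s‖ ≤ K := by
  obtain ⟨M, hM⟩ := isCompact_Icc.exists_bound_of_continuousOn
    (f := y) (s := Icc t T) (by simpa [uIcc_of_le htT] using hy.absCont.continuousOn)
  exact ⟨max M 1, by positivity, fun s hs => (hM s hs).trans (le_max_left _ _)⟩

lemma infPsi_le {s : ℝ} (hs : s ∈ Icc t T) (z : Rn n) : infPsi t T Ψ ≤ Ψ s z :=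
  (iInf₂_le s hs).trans (iInf_le _ z)

lemma infPsi_ne_top (htT : t ≤ T) (hK : 0 ≤ K) (hB : BPsi t T Ψ K) : infPsi t T Ψ ≠ ⊤ := by
  obtain ⟨M, hM⟩ := hB
  have ht := left_mem_Icc.2 htT
  exact ne_top_of_le_ne_top ENNReal.coe_ne_top
    ((infPsi_le ht 0).trans (hM t ht 0 (by simpa using hK)))

lemma pPsi_of_infPsi_pos (hm : 0 < infPsi t T Ψ) (hm' : infPsi t T Ψ ≠ ⊤) (K : ℝ) :
    PPsi t T Ψ K :=
  ⟨(infPsi t T Ψ).toNNReal, ENNReal.toNNReal_pos hm.ne' hm', fun s hs z _ => by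
    rw [ENNReal.coe_toNNReal hm']; exact infPsi_le hs z⟩

/-- With m = inf Ψ, growth gives m α |y'| ≤ Λ Ψ + m d almost everywhere along `y`; integrate over I.
-/
lemma GLambda.mul_norm_sub_le {α d : ℝ} (hG : GLambda t T Λ α d) (hα : 0 ≤ α) (hd : 0 ≤ d)
    (hp : 1 ≤ p) (htT : t ≤ T) (hy : MemW1p p t T y)
    {s : ℝ} (hs : s ∈ Icc t T) :
    infPsi t T Ψ * ENNReal.ofReal α * ENNReal.ofReal ‖y s - y t‖ ≤
      energy t T Λ Ψ y + infPsi t T Ψ * ENNReal.ofReal (d * (T - t)) := by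
  have hyi := hy.integrableOn_deriv hp
  have hsub : Icc t s ⊆ Icc t T := Icc_subset_Icc_right hs.2
  have h1 : ENNReal.ofReal ‖y s - y t‖ ≤ ∫⁻ x in Icc t T, ENNReal.ofReal ‖deriv y x‖ := by
    rw [← ofReal_integral_eq_lintegral_ofReal hyi.norm
      (Eventually.of_forall fun _ => norm_nonneg _)]
    refine ENNReal.ofReal_le_ofReal ?_
    have hii : IntegrableOn (deriv y) (uIcc t s) := by
      rw [uIcc_of_le hs.1]; exact hyi.mono_set hsub
    refine (norm_sub_le_integral_norm_deriv hs.1 (hy.absCont.mono ?_)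
      hii.intervalIntegrable).trans ?_
    · rwa [uIcc_of_le hs.1, uIcc_of_le htT]
    · rw [intervalIntegral.integral_of_le hs.1]
      exact setIntegral_mono_set hyi.norm (Eventually.of_forall fun _ => norm_nonneg _)
        (Ioc_subset_Icc_self.trans hsub).eventuallyLE
  have hmeas : Measurable fun x => ENNReal.ofReal ‖deriv y x‖ :=
    (measurable_deriv y).norm.ennreal_ofReal
  calc infPsi t T Ψ * ENNReal.ofReal α * ENNReal.ofReal ‖y s - y t‖
      ≤ infPsi t T Ψ * ENNReal.ofReal α * ∫⁻ x in Icc t T, ENNReal.ofReal ‖deriv y x‖ := by gcongr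
    _ = ∫⁻ x in Icc t T, infPsi t T Ψ * ENNReal.ofReal α * ENNReal.ofReal ‖deriv y x‖ :=
        (lintegral_const_mul _ hmeas).symm
    _ ≤ ∫⁻ x in Icc t T, (Λ x (y x) (deriv y x) * Ψ x (y x) +
          infPsi t T Ψ * ENNReal.ofReal d) := by
        refine lintegral_mono_ae ?_
        filter_upwards [hG, ae_restrict_mem measurableSet_Icc] with x hx hxI
        rw [mul_assoc, ← ENNReal.ofReal_mul hα]
        calc infPsi t T Ψ * ENNReal.ofReal (α * ‖deriv y x‖)
            ≤ infPsi t T Ψ * (Λ x (y x) (deriv y x) + ENNReal.ofReal d) := by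
              refine mul_le_mul_right ?_ _
              calc ENNReal.ofReal (α * ‖deriv y x‖)
                  = ENNReal.ofReal (α * ‖deriv y x‖ - d + d) := by rw [sub_add_cancel]
                _ ≤ ENNReal.ofReal (α * ‖deriv y x‖ - d) + ENNReal.ofReal d :=
                  ENNReal.ofReal_add_le
                _ ≤ _ := add_le_add_left (hx _ _) _
          _ ≤ _ := by
              rw [mul_add, mul_comm]
              gcongr
              exact infPsi_le hxI _
    _ = _ := by
        rw [lintegral_add_right _ measurable_const, setLIntegral_const, Real.volume_Icc,
          mul_assoc, ← ENNReal.ofReal_mul hd, energy]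

/-- Solved for ι, the threshold condition is a strict upper bound; that bound is the energy cutoff
below which trajectories stay in B_K. -/
lemma K₀_lt_iff {α d : ℝ} (hα : 0 < α) (hm : 0 < infPsi t T Ψ) (hm' : infPsi t T Ψ ≠ ⊤)
    (ι a : ℝ≥0∞) : K₀ t T Ψ X α d ι < a ↔
      ι < (a - ENNReal.ofReal ‖X‖) * (infPsi t T Ψ * ENNReal.ofReal α) -
        infPsi t T Ψ * ENNReal.ofReal (d * (T - t)) := by
  have h0 : infPsi t T Ψ * ENNReal.ofReal α ≠ 0 :=
    mul_ne_zero hm.ne' (ENNReal.ofReal_pos.2 hα).ne'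
  have h1 : infPsi t T Ψ * ENNReal.ofReal α ≠ ⊤ := ENNReal.mul_ne_top hm' ENNReal.ofReal_ne_top
  rw [K₀, ← lt_tsub_iff_left, ENNReal.div_lt_iff (Or.inl h0) (Or.inl h1), lt_tsub_iff_right]

lemma norm_le_of_K₀_energy_lt {α d : ℝ} (hG : GLambda t T Λ α d) (hα : 0 < α) (hd : 0 ≤ d)
    (hp : 1 ≤ p) (htT : t ≤ T) (hm : 0 < infPsi t T Ψ) (hm' : infPsi t T Ψ ≠ ⊤)
    (hy : MemW1p p t T y) (hyX : y t = X)
    (hK : K₀ t T Ψ X α d (energy t T Λ Ψ y) < ENNReal.ofReal K) {s : ℝ} (hs : s ∈ Icc t T) :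
    ‖y s‖ ≤ K := by
  have h0 : infPsi t T Ψ * ENNReal.ofReal α ≠ 0 :=
    mul_ne_zero hm.ne' (ENNReal.ofReal_pos.2 hα).ne'
  have h1 : infPsi t T Ψ * ENNReal.ofReal α ≠ ⊤ := ENNReal.mul_ne_top hm' ENNReal.ofReal_ne_top
  have h2 : ENNReal.ofReal ‖y s - X‖ ≤
      (energy t T Λ Ψ y + infPsi t T Ψ * ENNReal.ofReal (d * (T - t))) /
        (infPsi t T Ψ * ENNReal.ofReal α) := by
    rw [ENNReal.le_div_iff_mul_le (Or.inl h0) (Or.inl h1), mul_comm, ← hyX]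
    exact hG.mul_norm_sub_le hα.le hd hp htT hy hs
  have h3 : ENNReal.ofReal ‖y s‖ < ENNReal.ofReal K := by
    refine lt_of_le_of_lt ?_ hK
    calc ENNReal.ofReal ‖y s‖ ≤ ENNReal.ofReal (‖X‖ + ‖y s - X‖) :=
          ENNReal.ofReal_le_ofReal (by simpa using norm_add_le X (y s - X))
      _ = ENNReal.ofReal ‖X‖ + ENNReal.ofReal ‖y s - X‖ :=
          ENNReal.ofReal_add (norm_nonneg _) (norm_nonneg _)
      _ ≤ _ := add_le_add_right h2 _
  exact ((ENNReal.ofReal_lt_ofReal_iff_of_nonneg (norm_nonneg _)).1 h3).le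

/-- Under linear growth, it suffices to approximate trajectories with values in `B_K`, for one `K`
above the threshold. -/
lemma noLavrentiev_of_K₀_lt {α d : ℝ} (hG : GLambda t T Λ α d) (hα : 0 < α) (hd : 0 ≤ d)
    (hp : 1 ≤ p) (htT : t ≤ T) (hm : 0 < infPsi t T Ψ) (hB : BPsi t T Ψ K)
    {Γ : Set (ℝ → Rn n)} (hΓ : ∀ y ∈ Γ, MemW1p p t T y ∧ y t = X)
    (hK : K₀ t T Ψ X α d (infEnergy t T Λ Ψ Γ) < ENNReal.ofReal K)
    (h : PPsi t T Ψ K → ∀ y ∈ Γ, (∀ s ∈ Icc t T, ‖y s‖ ≤ K) → energy t T Λ Ψ y < ⊤ →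
      ∀ δ : ℝ≥0∞, 0 < δ → ∃ z ∈ Γ ∩ Lip t T, energy t T Λ Ψ z ≤ energy t T Λ Ψ y + δ) :
    NoLavrentiev t T Λ Ψ Γ := by
  have hK0 : 0 < K := ENNReal.ofReal_pos.1 (zero_le.trans_lt hK)
  have hm' := infPsi_ne_top htT hK0.le hB
  -- The equivalence serves twice: with ι the infimum it shows the cutoff is admissible, with ι =
  -- F(y) it bounds `y`.
  refine noLavrentiev_of_forall_exists (Or.inl ((K₀_lt_iff hα hm hm' _ _).1 hK))
    fun y hy hyE => ?_
  exact h (pPsi_of_infPsi_pos hm hm' K) y hy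
    (fun s hs => norm_le_of_K₀_energy_lt hG hα hd hp htT hm hm' (hΓ y hy).1 (hΓ y hy).2
      ((K₀_lt_iff hα hm hm' _ _).2 hyE) hs) (hyE.trans_le le_top)

end Problems

end Lavrentiev

theorem corollary1 (n : ℕ) (hn : 1 ≤ n) (p : ℝ) (hp : 1 ≤ p) (t T : ℝ) (htT : t < T)
    (Λ : ℝ → Lavrentiev.Rn n → Lavrentiev.Rn n → ℝ≥0∞) (Ψ : ℝ → Lavrentiev.Rn n → ℝ≥0∞)
    (hbasic : Lavrentiev.BasicAssumptions t T Λ Ψ)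
    (hS : Lavrentiev.ConditionS p t T Λ)
    (X : Lavrentiev.Rn n) :
    -- Claim 1
    ((∀ K : ℝ, 0 < K → Lavrentiev.BPsi t T Ψ K ∧ Lavrentiev.CPsi t T Ψ K ∧
        Lavrentiev.PPsi t T Ψ K ∧ Lavrentiev.BLambda t T Λ K) →
      Lavrentiev.NoLavrentiev t T Λ Ψ (Lavrentiev.Gamma₁ p t T X)) ∧
    -- Claim 2
    ((∀ K : ℝ, 0 < K → Lavrentiev.BPsi t T Ψ K ∧ Lavrentiev.CPsi t T Ψ K ∧
        Lavrentiev.PPsi t T Ψ K ∧ Lavrentiev.BLambda t T Λ K) →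
      Lavrentiev.RealValued t T Λ →
      (∀ K : ℝ, 0 < K → Lavrentiev.ULambda t T Λ K) →
      ∀ Y : Lavrentiev.Rn n,
        Lavrentiev.NoLavrentiev t T Λ Ψ (Lavrentiev.Gamma₂ p t T X Y)) ∧
    -- Claim 3
    (∀ α d : ℝ, 0 < α → 0 ≤ d → Lavrentiev.GLambda t T Λ α d →
      0 < Lavrentiev.infPsi t T Ψ →
      (∀ K : ℝ,
        Lavrentiev.K₀ t T Ψ X α d
          (Lavrentiev.infEnergy t T Λ Ψ (Lavrentiev.Gamma₁ p t T X)) < ENNReal.ofReal K →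
        Lavrentiev.BPsi t T Ψ K → Lavrentiev.CPsi t T Ψ K → Lavrentiev.BLambda t T Λ K →
        Lavrentiev.NoLavrentiev t T Λ Ψ (Lavrentiev.Gamma₁ p t T X)) ∧
      (∀ (Y : Lavrentiev.Rn n) (K : ℝ),
        Lavrentiev.K₀ t T Ψ X α d
          (Lavrentiev.infEnergy t T Λ Ψ (Lavrentiev.Gamma₂ p t T X Y)) < ENNReal.ofReal K →
        Lavrentiev.BPsi t T Ψ K → Lavrentiev.CPsi t T Ψ K → Lavrentiev.BLambda t T Λ K →
        Lavrentiev.ULambda t T Λ K →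
        Lavrentiev.NoLavrentiev t T Λ Ψ (Lavrentiev.Gamma₂ p t T X Y))) := by
  refine ⟨fun h => ?_, fun h _ hU Y => ?_, fun α d hα hd hG hm => ⟨fun K hK hB hC hΛ => ?_,
    fun Y K hK hB hC _ hU => ?_⟩⟩
  · refine Lavrentiev.noLavrentiev_of_forall_exists (Or.inr rfl) fun y hy hyE δ hδ => ?_
    -- Here K may depend on `y`, as the hypotheses hold for every K.
    obtain ⟨K, hK, hyK⟩ := hy.1.exists_norm_le htT.le
    obtain ⟨hB, hC, hP, hΛ⟩ := h K hK
    exact Lavrentiev.exists_lipschitz_mem_Gamma₁ hp htT hbasic hS hB hC hP hΛ hy hyK hyE hδ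
  · refine Lavrentiev.noLavrentiev_of_forall_exists (Or.inr rfl) fun y hy hyE δ hδ => ?_
    obtain ⟨K, hK, hyK⟩ := hy.1.exists_norm_le htT.le
    obtain ⟨hB, hC, hP, -⟩ := h K hK
    exact Lavrentiev.exists_lipschitz_mem_Gamma₂ hp htT hbasic hS hB hC hP (hU K hK) hy hyK hyE hδ
  · exact Lavrentiev.noLavrentiev_of_K₀_lt hG hα hd hp htT.le hm hB (fun y hy => hy) hK
      fun hP y hy hyK hyE δ hδ =>
        Lavrentiev.exists_lipschitz_mem_Gamma₁ hp htT hbasic hS hB hC hP hΛ hy hyK hyE hδ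
  · exact Lavrentiev.noLavrentiev_of_K₀_lt hG hα hd hp htT.le hm hB
      (fun y hy => ⟨hy.1, hy.2.1⟩) hK fun hP y hy hyK hyE δ hδ =>
        Lavrentiev.exists_lipschitz_mem_Gamma₂ hp htT hbasic hS hB hC hP hU hy hyK hyE hδ
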